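/- For real $s>0$ let $\eta(s)=\sum_{i=1}^{\infty}\frac{(-1)^{i-1}}{i^{s}}$ (limit of partial sums) be the Dirichlet eta function; in particular $\eta(1)=\ln 2$. For $n\ge 0$ put $$B_n=\frac{2}{7}\pi^2\sum_{j=1}^{n}\frac{\eta(j)}{(j+1)(j+2)},\qquad A_n=\frac{2}{7}\pi^2\Bigl(\frac{\eta(n+1)}{n+2}+\sum_{j=1}^{n}\frac{\eta(j)}{(j+1)(j+2)}\Bigr).$$ Then $$\zeta(3)=\lim_{n\to\infty}A_n=\frac{2}{7}\pi^2\sum_{j=1}^{\infty}\frac{\eta(j)}{(j+1)(j+2)},$$ where the series on the right converges (absolutely). Moreover the first formula converges faster than the second: $B_n\neq\zeta(3)$ for all $n$, and $$\lim_{n\to\infty}\frac{A_n-\zeta(3)}{B_n-\zeta(3)}=0 .$$ -/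

import Mathlib

open Filter Topology Asymptotics

/-- The `n`-th partial sum `∑_{i=1}^{n} (-1)^(i-1) / i^s` of the alternating series of the
Dirichlet eta function (the summation index is shifted by one). -/
noncomputable def etaPartial (s : ℝ) (n : ℕ) : ℝ :=
  ∑ i ∈ Finset.range n, (-1 : ℝ) ^ i / ((i : ℝ) + 1) ^ s

/-- The Dirichlet eta function `η(s) = ∑_{i ≥ 1} (-1)^(i-1) / i^s` for real `s > 0`. The series
is only conditionally convergent for `s ≤ 1`, so it is the limit of its partial sums. -/
noncomputable def dirichletEta (s : ℝ) : ℝ :=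
  limUnder atTop (etaPartial s)

/-- For `s > 0` the defining series converges to `dirichletEta s`. -/
theorem tendsto_etaPartial {s : ℝ} (hs : 0 < s) :
    Tendsto (etaPartial s) atTop (𝓝 (dirichletEta s)) := by
  have hanti : Antitone (fun i : ℕ => (((i : ℝ) + 1) ^ s)⁻¹) := by
    intro a b hab
    have h : (a : ℝ) ≤ b := by exact_mod_cast hab
    have ha : (0 : ℝ) < (a : ℝ) + 1 := by positivity
    exact inv_anti₀ (Real.rpow_pos_of_pos ha s)
      (Real.rpow_le_rpow ha.le (by linarith) hs.le)
  have hzero : Tendsto (fun i : ℕ => (((i : ℝ) + 1) ^ s)⁻¹) atTop (𝓝 0) :=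
    tendsto_inv_atTop_zero.comp ((tendsto_rpow_atTop hs).comp
      (tendsto_atTop_add_const_right _ _ tendsto_natCast_atTop_atTop))
  obtain ⟨l, hl⟩ := hanti.tendsto_alternating_series_of_tendsto_zero hzero
  have hl' : Tendsto (etaPartial s) atTop (𝓝 l) := by
    have h : etaPartial s =
        fun n => ∑ i ∈ Finset.range n, (-1 : ℝ) ^ i * (((i : ℝ) + 1) ^ s)⁻¹ := by
      funext n
      simp only [etaPartial, div_eq_mul_inv]
    rw [h]
    exact hl
  exact tendsto_nhds_limUnder ⟨l, hl'⟩

/-- The `n`-th approximation `(2/7) π² ∑_{j=1}^{n} η(j) / ((j+1)(j+2))`. -/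
noncomputable def plainApprox (n : ℕ) : ℝ :=
  2 / 7 * Real.pi ^ 2 *
    ∑ j ∈ Finset.Icc 1 n, 1 / (((j : ℝ) + 1) * ((j : ℝ) + 2)) * dirichletEta j

/-- The `n`-th approximation with boundary term,
`(2/7) π² (η(n+1) / (n+2) + ∑_{j=1}^{n} η(j) / ((j+1)(j+2)))`. -/
noncomputable def boundaryApprox (n : ℕ) : ℝ :=
  2 / 7 * Real.pi ^ 2 *
    (1 / ((n : ℝ) + 2) * dirichletEta ((n : ℝ) + 1) +
      ∑ j ∈ Finset.Icc 1 n, 1 / (((j : ℝ) + 1) * ((j : ℝ) + 2)) * dirichletEta j)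

/-!
The functional equation behind the theorem is `G(t) + G(1 - t) = π / sin (π t)` on `(0, 1)`, where
`G(t) = ∑ η(j + 1) t ^ j`: exchanging the two sums turns `G(t)` into `∑ (-1) ^ i / (i + 1 - t)`, and
the left side becomes the partial fraction expansion of the cosecant. Since
`∫ t (1 - t) t ^ j = 1 / ((j + 2) (j + 3))`, integrating against `t (1 - t)` shows that twice the
series of the theorem equals `∫ t (1 - t) π / sin (π t)`. The Fourier sine series of `t (1 - t)`
contains only the frequencies `(2 k + 1) π`, with coefficients proportional to `1 / (2 k + 1) ^ 3`;
after division by `sin (π t)` each sine becomes a Dirichlet kernel, whose integral is `1`, so the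
integral is a multiple of `∑ 1 / (2 k + 1) ^ 3 = 7 / 8 * ζ(3)`.
-/

section Series

theorem sum_alternating_mem_Icc {R : Type*} [CommRing R] [LinearOrder R] [IsStrictOrderedRing R]
    {f : ℕ → R} (hf : Antitone f) (hf₀ : ∀ i, 0 ≤ f i) (n : ℕ) :
    ∑ i ∈ Finset.range n, (-1) ^ i * f i ∈ Set.Icc 0 (f 0) := by
  induction n generalizing f with
  | zero => simpa using hf₀ 0
  | succ n ih =>
    have hshift : ∑ i ∈ Finset.range (n + 1), (-1) ^ i * f i =
        f 0 - ∑ i ∈ Finset.range n, (-1) ^ i * f (i + 1) := by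
      simp only [Finset.sum_range_succ', pow_succ, mul_neg_one, neg_mul, Finset.sum_neg_distrib,
        pow_zero, one_mul]
      ring
    have htail := ih (hf.comp_monotone fun _ _ h => Nat.succ_le_succ h) fun i => hf₀ (i + 1)
    have hdecr : f 1 ≤ f 0 := hf zero_le_one
    simp only [Function.comp_apply, Nat.succ_eq_add_one, zero_add, Set.mem_Icc] at htail
    rw [hshift, Set.mem_Icc]
    constructor <;> linarith [htail.1, htail.2]

variable {R : Type*} [NormedRing R] [CompleteSpace R] {f : ℕ → R} {a b : R}

theorem hasSum_odd_of_hasSum_even (hf : HasSum f a) (heven : HasSum (fun k => f (2 * k)) b) :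
    HasSum (fun k => f (2 * k + 1)) (a - b) := by
  have hodd : Summable fun k => f (2 * k + 1) :=
    hf.summable.comp_injective fun m n h => by simpa using h
  rw [← (heven.even_add_odd hodd.hasSum).unique hf, add_sub_cancel_left]
  exact hodd.hasSum

theorem hasSum_alternating_of_hasSum_even (hf : HasSum f a)
    (heven : HasSum (fun k => f (2 * k)) b) :
    HasSum (fun n => (-1) ^ n * f n) (2 * b - a) := by
  have hodd := (hasSum_odd_of_hasSum_even hf heven).neg
  rw [show 2 * b - a = b + -(a - b) by rw [two_mul]; abel]
  refine HasSum.even_add_odd ?_ ?_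
  · simpa [pow_mul] using heven
  · simpa [pow_mul, pow_succ] using hodd

theorem hasSum_one_div_mul_add_one {x : ℝ} (hx : 0 < x) :
    HasSum (fun j : ℕ => 1 / ((x + j) * (x + j + 1))) (1 / x) := by
  have hsub (j : ℕ) : 1 / ((x + j) * (x + j + 1)) = 1 / (x + j) - 1 / (x + (j + 1 : ℕ)) := by
    push_cast
    field_simp
    ring
  rw [hasSum_iff_tendsto_nat_of_nonneg fun j => by positivity]
  simp only [hsub, Finset.sum_range_sub', Nat.cast_zero, add_zero]
  have hlim : Tendsto (fun n : ℕ => 1 / (x + n)) atTop (𝓝 0) :=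
    tendsto_const_nhds.div_atTop (tendsto_atTop_add_const_left _ _ tendsto_natCast_atTop_atTop)
  simpa using hlim.const_sub (1 / x)

end Series

section EtaBounds

theorem etaPartial_eq_sum (s : ℝ) (n : ℕ) :
    etaPartial s n = ∑ i ∈ Finset.range n, (-1 : ℝ) ^ i * (1 / ((i : ℝ) + 1) ^ s) := by
  simp only [etaPartial, mul_one_div]

theorem antitone_one_div_add_one_rpow {s : ℝ} (hs : 0 ≤ s) :
    Antitone fun i : ℕ => 1 / ((i : ℝ) + 1) ^ s := by
  intro i j hij
  dsimp only
  gcongr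

theorem etaPartial_mem_Icc {s : ℝ} (hs : 0 ≤ s) (n : ℕ) : etaPartial s n ∈ Set.Icc 0 1 := by
  simpa [etaPartial_eq_sum] using
    sum_alternating_mem_Icc (antitone_one_div_add_one_rpow hs) (fun i => by positivity) n

theorem dirichletEta_mem_Icc {s : ℝ} (hs : 0 < s) : dirichletEta s ∈ Set.Icc 0 1 :=
  isClosed_Icc.mem_of_tendsto (tendsto_etaPartial hs)
    (.of_forall (etaPartial_mem_Icc hs.le))

theorem abs_dirichletEta_le_one {s : ℝ} (hs : 0 < s) : |dirichletEta s| ≤ 1 := by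
  rw [abs_of_nonneg (dirichletEta_mem_Icc hs).1]
  exact (dirichletEta_mem_Icc hs).2

theorem one_sub_half_rpow_le_dirichletEta {s : ℝ} (hs : 0 < s) :
    1 - (1 / 2) ^ s ≤ dirichletEta s := by
  have hlim := tendsto_etaPartial hs
  simp only [funext (etaPartial_eq_sum s)] at hlim
  calc 1 - (1 / 2 : ℝ) ^ s
      = ∑ i ∈ Finset.range (2 * 1), (-1 : ℝ) ^ i * (1 / ((i : ℝ) + 1) ^ s) := by
        norm_num [Finset.sum_range_succ, Real.div_rpow, sub_eq_add_neg]
    _ ≤ dirichletEta s :=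
        (antitone_one_div_add_one_rpow hs.le).alternating_series_le_tendsto hlim 1

theorem dirichletEta_one : dirichletEta 1 = Real.log 2 := by
  have hsum : Tendsto (fun n => ∑ i ∈ Finset.range n, (-1 : ℝ) ^ i / ((i : ℝ) + 1)) atTop
      (𝓝 (dirichletEta 1)) := by
    simpa only [funext (etaPartial_eq_sum 1), mul_one_div, Real.rpow_one] using
      tendsto_etaPartial zero_lt_one
  have hid : Tendsto (fun x : ℝ => x) (𝓝[<] 1) (𝓝 1) := nhdsWithin_le_nhds
  have habel := hid.mul (Real.tendsto_tsum_powerSeries_nhdsWithin_lt hsum)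
  have hlog : Tendsto (fun x : ℝ => Real.log (1 + x)) (𝓝[<] 1) (𝓝 (Real.log (1 + 1))) :=
    (hid.const_add 1).log (by norm_num)
  rw [one_mul] at habel
  rw [one_add_one_eq_two] at hlog
  refine tendsto_nhds_unique (habel.congr' ?_) hlog
  filter_upwards [Ioo_mem_nhdsLT (zero_lt_one (α := ℝ))] with x hx
  have htaylor := (Real.hasSum_pow_div_log_of_abs_lt_one (x := -x)
    (by rw [abs_neg, abs_of_pos hx.1]; exact hx.2)).neg
  rw [neg_neg, sub_neg_eq_add] at htaylor
  rw [← htaylor.tsum_eq, ← tsum_mul_left]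
  refine tsum_congr fun n => ?_
  rw [neg_pow x (n + 1)]
  ring

end EtaBounds

section GeneratingFunction

/-- The generating function `∑_{j ≥ 0} η(j + 1) t ^ j` of the values of the Dirichlet eta function
at the positive integers. The series converges for `|t| < 1`. -/
noncomputable def etaGenFun (t : ℝ) : ℝ :=
  ∑' j : ℕ, dirichletEta ((j : ℝ) + 1) * t ^ j

theorem hasSum_etaPartial_mul_pow {t : ℝ} (ht : |t| < 1) (n : ℕ) :
    HasSum (fun j : ℕ => etaPartial ((j : ℝ) + 1) n * t ^ j)
      (∑ i ∈ Finset.range n, (-1 : ℝ) ^ i / ((i : ℝ) + 1 - t)) := by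
  simp only [etaPartial, Finset.sum_mul]
  refine hasSum_sum fun i _ => ?_
  have hi : (1 : ℝ) ≤ (i : ℝ) + 1 := by simp
  have hratio : |t / ((i : ℝ) + 1)| < 1 := by
    rw [abs_div, abs_of_pos (zero_lt_one.trans_le hi), div_lt_one (zero_lt_one.trans_le hi)]
    exact ht.trans_le hi
  have hne : (i : ℝ) + 1 - t ≠ 0 := by linarith [(abs_lt.1 ht).2]
  convert! (hasSum_geometric_of_abs_lt_one hratio).mul_left ((-1 : ℝ) ^ i / ((i : ℝ) + 1)) using 1
  · funext j
    rw [div_pow, ← Nat.cast_add_one j, Real.rpow_natCast, pow_succ]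
    field_simp
  · rw [one_sub_div (by positivity)]
    field_simp

theorem tendsto_sum_alternating_div_etaGenFun {t : ℝ} (ht : |t| < 1) :
    Tendsto (fun n => ∑ i ∈ Finset.range n, (-1 : ℝ) ^ i / ((i : ℝ) + 1 - t)) atTop
      (𝓝 (etaGenFun t)) := by
  simp only [← (hasSum_etaPartial_mul_pow ht _).tsum_eq]
  refine tendsto_tsum_of_dominated_convergence (bound := fun j => |t| ^ j)
    (summable_geometric_of_lt_one (abs_nonneg t) ht)
    (fun j => (tendsto_etaPartial (by positivity)).mul_const _) (.of_forall fun n j => ?_)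
  have hη := etaPartial_mem_Icc (s := (j : ℝ) + 1) (by positivity) n
  rw [norm_mul, norm_pow, Real.norm_eq_abs, Real.norm_eq_abs, abs_of_nonneg hη.1]
  exact mul_le_of_le_one_left (by positivity) hη.2

theorem hasSum_cot {z : ℂ} (hz : z ∈ Complex.integerComplement) :
    HasSum (fun n : ℕ => 1 / (z - n) + 1 / (z + n))
      (Real.pi * Complex.cot (Real.pi * z) + 1 / z) := by
  rw [← hasSum_nat_add_iff' 1]
  convert! (summable_cotTerm hz).hasSum using 1
  · funext n
    simp [cotTerm]
  · simp only [cotTerm]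
    rw [← cot_series_rep' hz]
    simp

theorem one_div_sin_eq_cot_sub_cot (z : ℂ) :
    1 / Complex.sin z = Complex.cot (z / 2) - Complex.cot z := by
  obtain ⟨w, rfl⟩ : ∃ w, z = 2 * w := ⟨z / 2, by ring⟩
  rw [mul_div_cancel_left₀ w two_ne_zero, Complex.cot_eq_cos_div_sin, Complex.cot_eq_cos_div_sin,
    Complex.sin_two_mul, Complex.cos_two_mul]
  by_cases hs : Complex.sin w = 0
  · simp [hs]
  by_cases hc : Complex.cos w = 0
  · simp [hc]
  field_simp
  ring

theorem hasSum_alternating_csc {z : ℂ} (hz : z ∈ Complex.integerComplement) :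
    HasSum (fun n : ℕ => (-1) ^ n * (1 / (z - n) + 1 / (z + n)))
      (Real.pi / Complex.sin (Real.pi * z) + 1 / z) := by
  have hz' : z / 2 ∈ Complex.integerComplement := by
    rintro ⟨n, hn⟩
    exact hz ⟨2 * n, by push_cast; rw [hn]; ring⟩
  have heven : HasSum (fun k : ℕ => 1 / (z - (2 * k : ℕ)) + 1 / (z + (2 * k : ℕ)))
      (1 / 2 * (Real.pi * Complex.cot (Real.pi * (z / 2)) + 1 / (z / 2))) := by
    refine ((hasSum_cot hz').mul_left (1 / 2)).congr_fun fun k => ?_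
    rw [show z / 2 - k = (z - (2 * k : ℕ)) / 2 by push_cast; ring,
      show z / 2 + k = (z + (2 * k : ℕ)) / 2 by push_cast; ring, one_div_div, one_div_div]
    ring
  convert! hasSum_alternating_of_hasSum_even (hasSum_cot hz) heven using 1
  rw [← mul_one_div (Real.pi : ℂ), one_div_sin_eq_cot_sub_cot, mul_div_assoc, one_div_div]
  ring

theorem hasSum_alternating_csc_real {t : ℝ} (ht : t ∉ Set.range ((↑) : ℤ → ℝ)) :
    HasSum (fun n : ℕ => (-1 : ℝ) ^ n * (1 / (t - n) + 1 / (t + n)))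
      (Real.pi / Real.sin (Real.pi * t) + 1 / t) := by
  have hz : (t : ℂ) ∈ Complex.integerComplement := by
    rintro ⟨n, hn⟩
    exact ht ⟨n, by exact_mod_cast hn⟩
  exact_mod_cast hasSum_alternating_csc hz

theorem etaGenFun_add_etaGenFun_one_sub {t : ℝ} (ht : t ∈ Set.Ioo (0 : ℝ) 1) :
    etaGenFun t + etaGenFun (1 - t) = Real.pi / Real.sin (Real.pi * t) := by
  have hint : t ∉ Set.range ((↑) : ℤ → ℝ) := by
    rintro ⟨n, rfl⟩
    have hpos : 0 < n := by exact_mod_cast ht.1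
    have hlt : n < 1 := by exact_mod_cast ht.2
    omega
  have hcsc := ((hasSum_alternating_csc_real hint).tendsto_sum_nat.comp
    (tendsto_add_atTop_nat 1)).sub_const (1 / t)
  have hleft := tendsto_sum_alternating_div_etaGenFun (abs_lt.2 ⟨by linarith [ht.1], ht.2⟩)
  have hright := (tendsto_sum_alternating_div_etaGenFun (t := 1 - t)
    (abs_lt.2 ⟨by linarith [ht.2], by linarith [ht.1]⟩)).comp (tendsto_add_atTop_nat 1)
  rw [add_sub_cancel_right] at hcsc
  refine tendsto_nhds_unique ((hleft.add hright).congr fun n => ?_) hcsc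
  have hterm (i : ℕ) : (-1 : ℝ) ^ (i + 1) * (1 / (t - (i + 1 : ℕ))) =
      (-1) ^ i / ((i : ℝ) + 1 - t) := by
    rw [← neg_sub, one_div_neg_eq_neg_one_div]
    push_cast
    ring
  simp only [Function.comp_apply, mul_add, Finset.sum_add_distrib]
  rw [Finset.sum_range_succ' (fun i : ℕ => (-1 : ℝ) ^ i * (1 / (t - i)))]
  simp only [hterm, Nat.cast_zero, sub_zero, pow_zero, mul_one_div,
    show ∀ i : ℕ, (i : ℝ) + 1 - (1 - t) = t + i from fun i => by ring]
  ring

end GeneratingFunction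

section Integration

open MeasureTheory

theorem hasSum_mul_one_sub_mul_pow_add_pow {t : ℝ} (ht : t ∈ Set.Ioo (0 : ℝ) 1) :
    HasSum (fun j : ℕ => t * (1 - t) * (t ^ j + (1 - t) ^ j)) 1 := by
  have ht₀ : t ≠ 0 := ht.1.ne'
  have ht₁ : 1 - t ≠ 0 := (sub_pos.2 ht.2).ne'
  convert! ((hasSum_geometric_of_lt_one ht.1.le ht.2).add
    (hasSum_geometric_of_lt_one (sub_pos.2 ht.2).le (sub_lt_self 1 ht.1))).mul_left
      (t * (1 - t)) using 1
  rw [sub_sub_cancel]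
  field_simp
  ring

theorem integral_mul_one_sub_mul_pow_add_pow (j : ℕ) :
    ∫ t in Set.Ioo (0 : ℝ) 1, t * (1 - t) * (t ^ j + (1 - t) ^ j) =
      2 / (((j : ℝ) + 2) * (j + 3)) := by
  have hpow : ∫ t in (0 : ℝ)..1, t * (1 - t) * t ^ j = 1 / (((j : ℝ) + 2) * (j + 3)) := by
    have hexpand (t : ℝ) : t * (1 - t) * t ^ j = t ^ (j + 1) - t ^ (j + 2) := by ring
    simp only [hexpand]
    rw [intervalIntegral.integral_sub (by simp) (by simp), integral_pow, integral_pow]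
    push_cast
    simp only [one_pow, zero_pow (Nat.succ_ne_zero _), sub_zero]
    field_simp
    ring
  have hreflect := intervalIntegral.integral_comp_sub_left (a := 0) (b := 1)
    (fun t : ℝ => t * (1 - t) * t ^ j) 1
  simp only [sub_sub_cancel, sub_self, sub_zero, hpow] at hreflect
  have hsplit (t : ℝ) : t * (1 - t) * (t ^ j + (1 - t) ^ j) =
      t * (1 - t) * t ^ j + (1 - t) * t * (1 - t) ^ j := by ring
  rw [← integral_Ioc_eq_integral_Ioo, ← intervalIntegral.integral_of_le zero_le_one]
  simp only [hsplit]
  rw [intervalIntegral.integral_add (Continuous.intervalIntegrable (by fun_prop) _ _)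
    (Continuous.intervalIntegrable (by fun_prop) _ _), hpow, hreflect]
  ring

theorem hasSum_mul_integral_of_abs_le {a : ℕ → ℝ} {C : ℝ} (ha : ∀ j, |a j| ≤ C) :
    HasSum (fun j : ℕ => a j * (2 / (((j : ℝ) + 2) * (j + 3))))
      (∫ t in Set.Ioo (0 : ℝ) 1,
        t * (1 - t) * (∑' j, a j * t ^ j + ∑' j, a j * (1 - t) ^ j)) := by
  have hweight {t : ℝ} (ht : t ∈ Set.Ioo (0 : ℝ) 1) :=
    (hasSum_mul_one_sub_mul_pow_add_pow ht).mul_left C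
  have hsummable {t : ℝ} (ht : t ∈ Set.Ioo (0 : ℝ) 1) : Summable fun j => a j * t ^ j := by
    refine .of_norm_bounded ((summable_geometric_of_lt_one ht.1.le ht.2).mul_left C) fun j => ?_
    rw [norm_mul, norm_pow, Real.norm_of_nonneg ht.1.le]
    exact mul_le_mul_of_nonneg_right (ha j) (pow_nonneg ht.1.le j)
  simp only [← integral_mul_one_sub_mul_pow_add_pow, ← integral_const_mul]
  refine hasSum_integral_of_dominated_convergence
    (fun j t => C * (t * (1 - t) * (t ^ j + (1 - t) ^ j)))
    (fun j => Continuous.aestronglyMeasurable (by fun_prop))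
    (fun j => ae_restrict_of_forall_mem measurableSet_Ioo fun t ht => ?_)
    (ae_restrict_of_forall_mem measurableSet_Ioo fun t ht => (hweight ht).summable) ?_
    (ae_restrict_of_forall_mem measurableSet_Ioo fun t ht => ?_)
  · have ht₀ := ht.1.le
    have ht₁ := sub_nonneg.2 ht.2.le
    rw [norm_mul, Real.norm_of_nonneg (by positivity : 0 ≤ t * (1 - t) * (t ^ j + (1 - t) ^ j))]
    exact mul_le_mul_of_nonneg_right (ha j) (by positivity)
  · exact (integrableOn_congr_fun (fun t ht => (hweight ht).tsum_eq) measurableSet_Ioo).2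
      (integrableOn_const (by simp))
  · have ht' : 1 - t ∈ Set.Ioo (0 : ℝ) 1 := ⟨sub_pos.2 ht.2, sub_lt_self 1 ht.1⟩
    refine (((hsummable ht).hasSum.add (hsummable ht').hasSum).mul_left
      (t * (1 - t))).congr_fun fun j => ?_
    ring

end Integration

section DirichletKernel

open MeasureTheory

/-- The Dirichlet kernel `1 + 2 ∑_{m=1}^{n} cos (2 m x)`, with the argument doubled so that it
equals `sin ((2 n + 1) x) / sin x`. -/
noncomputable def dirichletKernel (n : ℕ) (x : ℝ) : ℝ :=
  1 + 2 * ∑ m ∈ Finset.range n, Real.cos (2 * ((m : ℝ) + 1) * x)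

theorem dirichletKernel_mul_sin (n : ℕ) (x : ℝ) :
    dirichletKernel n x * Real.sin x = Real.sin ((2 * n + 1) * x) := by
  induction n with
  | zero => simp [dirichletKernel]
  | succ n ih =>
    have hsub := Real.sin_sub_sin ((2 * (n + 1 : ℕ) + 1) * x) ((2 * n + 1) * x)
    rw [show ((2 * (n + 1 : ℕ) + 1) * x - (2 * n + 1) * x) / 2 = x by push_cast; ring,
      show ((2 * (n + 1 : ℕ) + 1) * x + (2 * n + 1) * x) / 2 = 2 * ((n : ℝ) + 1) * x by
        push_cast; ring] at hsub
    rw [dirichletKernel] at ih ⊢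
    rw [Finset.sum_range_succ]
    linear_combination ih - hsub

theorem abs_dirichletKernel_le (n : ℕ) (x : ℝ) : |dirichletKernel n x| ≤ 2 * n + 1 := by
  have hsum : |∑ m ∈ Finset.range n, Real.cos (2 * ((m : ℝ) + 1) * x)| ≤ n := by
    simpa using Finset.abs_sum_le_sum_abs _ _ |>.trans
      (Finset.sum_le_card_nsmul (Finset.range n) _ 1 fun m _ => Real.abs_cos_le_one _)
  calc |dirichletKernel n x| ≤ |1| + |2 * ∑ m ∈ Finset.range n, _| := abs_add_le _ _
    _ ≤ 2 * n + 1 := by rw [abs_mul, abs_one, abs_two]; linarith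

theorem continuous_dirichletKernel (n : ℕ) : Continuous (dirichletKernel n) := by
  unfold dirichletKernel
  fun_prop

theorem integral_dirichletKernel (n : ℕ) :
    ∫ t in Set.Ioo (0 : ℝ) 1, dirichletKernel n (Real.pi * t) = 1 := by
  have hcos (m : ℕ) : ∫ t in (0 : ℝ)..1, Real.cos (2 * ((m : ℝ) + 1) * (Real.pi * t)) = 0 := by
    have hne : 2 * ((m : ℝ) + 1) * Real.pi ≠ 0 := by positivity
    have hsin : Real.sin (2 * ((m : ℝ) + 1) * Real.pi) = 0 := by
      exact_mod_cast Real.sin_nat_mul_pi (2 * (m + 1))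
    simp only [← mul_assoc]
    rw [intervalIntegral.integral_comp_mul_left _ hne, integral_cos]
    simp [hsin]
  rw [← integral_Ioc_eq_integral_Ioo, ← intervalIntegral.integral_of_le zero_le_one]
  unfold dirichletKernel
  rw [intervalIntegral.integral_add (by simp)
      (Continuous.intervalIntegrable (by fun_prop) _ _), intervalIntegral.integral_const_mul,
    intervalIntegral.integral_finsetSum fun m _ => Continuous.intervalIntegrable (by fun_prop) _ _]
  simp [hcos]

end DirichletKernel

section Apery

open MeasureTheory

/-- Apéry's constant `ζ(3) = ∑ 1 / n ^ 3` as a real number; the term `n = 0` is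
`1 / 0 = 0`. -/
noncomputable def aperyConstant : ℝ :=
  ∑' n : ℕ, 1 / (n : ℝ) ^ 3

theorem riemannZeta_three : riemannZeta 3 = aperyConstant := by
  rw [aperyConstant]
  push_cast
  exact_mod_cast zeta_nat_eq_tsum_of_gt_one (k := 3) (by norm_num)

theorem hasSum_one_div_odd_cube :
    HasSum (fun k : ℕ => 1 / (2 * (k : ℝ) + 1) ^ 3) (7 / 8 * aperyConstant) := by
  have hcube : HasSum (fun n : ℕ => 1 / (n : ℝ) ^ 3) aperyConstant :=
    (Real.summable_one_div_nat_pow.2 (by norm_num)).hasSum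
  have heven : HasSum (fun k : ℕ => 1 / ((2 * k : ℕ) : ℝ) ^ 3) (1 / 8 * aperyConstant) := by
    refine (hcube.mul_left (1 / 8)).congr_fun fun k => ?_
    push_cast
    rw [mul_pow, one_div_mul_one_div]
    norm_num
  convert! hasSum_odd_of_hasSum_even hcube heven using 1
  · push_cast
    rfl
  · ring

theorem eval_bernoulli_three (x : ℝ) :
    ((Polynomial.bernoulli 3).map (algebraMap ℚ ℝ)).eval x = x ^ 3 - 3 / 2 * x ^ 2 + x / 2 := by
  have hzero : bernoulli 3 = 0 := bernoulli_eq_zero_of_odd (by decide) (by norm_num)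
  rw [Polynomial.bernoulli_def]
  simp only [Finset.sum_range_succ, Finset.range_one, Finset.sum_singleton, Nat.reduceAdd,
    Nat.reduceSub, Nat.add_one_sub_one, tsub_zero, tsub_self, Nat.choose, bernoulli_zero,
    bernoulli_one, bernoulli_two, hzero, Polynomial.map_add, Polynomial.map_monomial,
    Polynomial.eval_add, Polynomial.eval_monomial, eq_ratCast]
  push_cast
  ring

theorem hasSum_sin_div_cube {x : ℝ} (hx : x ∈ Set.Icc (0 : ℝ) 1) :
    HasSum (fun n : ℕ => 1 / (n : ℝ) ^ 3 * Real.sin (2 * Real.pi * n * x))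
      (2 * Real.pi ^ 3 / 3 * (x ^ 3 - 3 / 2 * x ^ 2 + x / 2)) := by
  convert! hasSum_one_div_nat_pow_mul_sin one_ne_zero hx using 1
  rw [show 2 * 1 + 1 = 3 from rfl, eval_bernoulli_three, show Nat.factorial 3 = 6 from rfl]
  push_cast
  ring

theorem hasSum_sin_odd_div_cube {t : ℝ} (ht : t ∈ Set.Icc (0 : ℝ) 1) :
    HasSum (fun k : ℕ => 1 / (2 * (k : ℝ) + 1) ^ 3 * Real.sin ((2 * k + 1) * (Real.pi * t)))
      (Real.pi ^ 3 / 8 * (t * (1 - t))) := by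
  have hall := hasSum_sin_div_cube (x := t / 2) ⟨by linarith [ht.1], by linarith [ht.2]⟩
  have heven : HasSum (fun k : ℕ => 1 / ((2 * k : ℕ) : ℝ) ^ 3 *
      Real.sin (2 * Real.pi * (2 * k : ℕ) * (t / 2)))
      (1 / 8 * (2 * Real.pi ^ 3 / 3 * (t ^ 3 - 3 / 2 * t ^ 2 + t / 2))) := by
    refine ((hasSum_sin_div_cube ht).mul_left (1 / 8)).congr_fun fun k => ?_
    rw [show 2 * Real.pi * ((2 * k : ℕ) : ℝ) * (t / 2) = 2 * Real.pi * k * t by push_cast; ring,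
      ← mul_assoc, one_div_mul_one_div]
    push_cast
    rw [mul_pow]
    norm_num
  convert! hasSum_odd_of_hasSum_even hall heven using 1
  · funext k
    push_cast
    ring_nf
  · ring

theorem hasSum_dirichletKernel_div_odd_cube {t : ℝ} (ht : t ∈ Set.Ioo (0 : ℝ) 1) :
    HasSum (fun k : ℕ => 1 / (2 * (k : ℝ) + 1) ^ 3 * dirichletKernel k (Real.pi * t))
      (Real.pi ^ 2 / 8 * (t * (1 - t) * (Real.pi / Real.sin (Real.pi * t)))) := by
  have hsin : Real.sin (Real.pi * t) ≠ 0 :=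
    (Real.sin_pos_of_pos_of_lt_pi (mul_pos Real.pi_pos ht.1)
      (mul_lt_of_lt_one_right Real.pi_pos ht.2)).ne'
  convert! (hasSum_sin_odd_div_cube (Set.Ioo_subset_Icc_self ht)).div_const
    (Real.sin (Real.pi * t)) using 1
  · funext k
    rw [← dirichletKernel_mul_sin, ← mul_assoc, mul_div_cancel_right₀ _ hsin]
  · ring

theorem summable_one_div_odd_sq : Summable fun k : ℕ => 1 / (2 * (k : ℝ) + 1) ^ 2 := by
  have hinj : Function.Injective fun k : ℕ => 2 * k + 1 := fun m n h => by simpa using h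
  simpa [Function.comp_def] using
    ((Real.summable_one_div_nat_pow (p := 2)).2 one_lt_two).comp_injective hinj

theorem integral_mul_one_sub_mul_pi_div_sin :
    ∫ t in Set.Ioo (0 : ℝ) 1, t * (1 - t) * (Real.pi / Real.sin (Real.pi * t)) =
      7 / Real.pi ^ 2 * aperyConstant := by
  have hbound (k : ℕ) (t : ℝ) :
      ‖1 / (2 * (k : ℝ) + 1) ^ 3 * dirichletKernel k (Real.pi * t)‖ ≤ 1 / (2 * k + 1) ^ 2 :=
    calc ‖1 / (2 * (k : ℝ) + 1) ^ 3 * dirichletKernel k (Real.pi * t)‖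
        = 1 / (2 * (k : ℝ) + 1) ^ 3 * |dirichletKernel k (Real.pi * t)| := by
          rw [norm_mul, Real.norm_of_nonneg (by positivity), Real.norm_eq_abs]
      _ ≤ 1 / (2 * (k : ℝ) + 1) ^ 3 * (2 * k + 1) := by
          gcongr
          exact abs_dirichletKernel_le k _
      _ = 1 / (2 * k + 1) ^ 2 := by field_simp
  have hsum := hasSum_integral_of_dominated_convergence
    (μ := volume.restrict (Set.Ioo (0 : ℝ) 1))
    (fun (k : ℕ) (_ : ℝ) => 1 / (2 * (k : ℝ) + 1) ^ 2)
    (fun k => (((continuous_dirichletKernel k).comp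
      (continuous_const_mul Real.pi)).const_mul _).aestronglyMeasurable)
    (fun k => .of_forall (hbound k)) (.of_forall fun _ => summable_one_div_odd_sq)
    (integrable_const _)
    (ae_restrict_of_forall_mem measurableSet_Ioo fun t => hasSum_dirichletKernel_div_odd_cube)
  simp only [integral_const_mul, Function.comp_apply, integral_dirichletKernel, mul_one] at hsum
  have hval := hsum.unique hasSum_one_div_odd_cube
  have hpi := Real.pi_ne_zero
  field_simp at hval ⊢
  linear_combination hval

end Apery

section Convergence

/-- The `j`-th term `η(j) / ((j + 1) (j + 2))` of the series for `ζ(3)`, which starts at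
`j = 1`. -/
noncomputable def etaTerm (j : ℕ) : ℝ :=
  1 / (((j : ℝ) + 1) * ((j : ℝ) + 2)) * dirichletEta j

theorem hasSum_etaTerm_succ :
    HasSum (fun j => etaTerm (j + 1)) (7 / (2 * Real.pi ^ 2) * aperyConstant) := by
  have hsum := (hasSum_mul_integral_of_abs_le (a := fun j => dirichletEta ((j : ℝ) + 1))
    fun j => abs_dirichletEta_le_one (by positivity)).mul_left (1 / 2)
  have hint : ∫ t in Set.Ioo (0 : ℝ) 1, t * (1 - t) * (etaGenFun t + etaGenFun (1 - t)) =
      7 / Real.pi ^ 2 * aperyConstant := by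
    rw [← integral_mul_one_sub_mul_pi_div_sin]
    exact MeasureTheory.setIntegral_congr_fun measurableSet_Ioo fun t ht => by
      simp only [etaGenFun_add_etaGenFun_one_sub ht]
  simp only [etaGenFun] at hint
  rw [hint] at hsum
  convert! hsum using 1
  · funext j
    simp only [etaTerm]
    push_cast
    ring
  · ring

theorem aperyConstant_eq_mul_tsum_etaTerm :
    aperyConstant = 2 / 7 * Real.pi ^ 2 * ∑' j : ℕ, etaTerm (j + 1) := by
  rw [hasSum_etaTerm_succ.tsum_eq]
  field_simp

theorem plainApprox_eq (n : ℕ) :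
    plainApprox n = 2 / 7 * Real.pi ^ 2 * ∑ j ∈ Finset.range n, etaTerm (j + 1) := by
  rw [plainApprox, ← Finset.Ico_succ_right_eq_Icc, Finset.sum_Ico_eq_sum_range]
  simp [etaTerm, add_comm 1]

theorem boundaryApprox_eq (n : ℕ) :
    boundaryApprox n =
      plainApprox n + 2 / 7 * Real.pi ^ 2 / ((n : ℝ) + 2) * dirichletEta ((n : ℝ) + 1) := by
  rw [boundaryApprox, plainApprox]
  ring

theorem aperyConstant_sub_plainApprox_eq (n : ℕ) :
    aperyConstant - plainApprox n = 2 / 7 * Real.pi ^ 2 * ∑' j : ℕ, etaTerm (j + n + 1) := by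
  rw [aperyConstant_eq_mul_tsum_etaTerm, plainApprox_eq, ← mul_sub,
    ← hasSum_etaTerm_succ.summable.sum_add_tsum_nat_add n, add_sub_cancel_left]

theorem dirichletEta_mem_Icc_one_sub {n k : ℕ} (hn : n ≠ 0) (hk : n ≤ k) :
    dirichletEta k ∈ Set.Icc (1 - (1 / 2) ^ n) 1 := by
  have hk_pos : (0 : ℝ) < k := by exact_mod_cast (Nat.pos_of_ne_zero hn).trans_le hk
  have hpow : ((1 : ℝ) / 2) ^ k ≤ (1 / 2) ^ n :=
    pow_le_pow_of_le_one (by norm_num) (by norm_num) hk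
  have hlower := one_sub_half_rpow_le_dirichletEta hk_pos
  rw [Real.rpow_natCast] at hlower
  exact ⟨(sub_le_sub_left hpow 1).trans hlower, (dirichletEta_mem_Icc hk_pos).2⟩

theorem tsum_etaTerm_mem_Icc (n : ℕ) :
    ∑' j : ℕ, etaTerm (j + n + 1) ∈
      Set.Icc (1 / ((n : ℝ) + 2) * (1 - (1 / 2) ^ (n + 1))) (1 / ((n : ℝ) + 2)) := by
  have hweight := hasSum_one_div_mul_add_one (x := (n : ℝ) + 2) (by positivity)
  have htail := ((summable_nat_add_iff n).2 hasSum_etaTerm_succ.summable).hasSum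
  have hterm (j : ℕ) : etaTerm (j + n + 1) =
      1 / (((n : ℝ) + 2 + j) * ((n : ℝ) + 2 + j + 1)) * dirichletEta (j + n + 1 : ℕ) := by
    simp only [etaTerm]
    push_cast
    ring_nf
  have hη (j : ℕ) := dirichletEta_mem_Icc_one_sub n.succ_ne_zero
    (show n + 1 ≤ j + n + 1 by omega)
  refine ⟨hasSum_le (fun j => ?_) (hweight.mul_right _) htail,
    hasSum_le (fun j => ?_) htail hweight⟩
  · rw [hterm]
    exact mul_le_mul_of_nonneg_left (hη j).1 (by positivity)
  · rw [hterm]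
    exact mul_le_of_le_one_right (by positivity) (hη j).2

theorem plainApprox_lt_aperyConstant (n : ℕ) : plainApprox n < aperyConstant := by
  have hpow : ((1 : ℝ) / 2) ^ (n + 1) < 1 :=
    pow_lt_one₀ (by norm_num) (by norm_num) n.succ_ne_zero
  have htail : 0 < ∑' j : ℕ, etaTerm (j + n + 1) :=
    (mul_pos (by positivity) (sub_pos.2 hpow)).trans_le (tsum_etaTerm_mem_Icc n).1
  rw [← sub_pos, aperyConstant_sub_plainApprox_eq]
  positivity

theorem abs_mul_sub_le_of_mem_Icc {w ε x y : ℝ} (hw : 0 ≤ w) (hε : ε ≤ 1 / 2)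
    (hx : x ∈ Set.Icc (1 - ε) 1) (hy : y ∈ Set.Icc (w * (1 - ε)) w) :
    |w * x - y| ≤ 2 * ε * |y| := by
  obtain ⟨hx_ge, hx_le⟩ := hx
  obtain ⟨hy_ge, hy_le⟩ := hy
  have hε_nonneg : 0 ≤ ε := by linarith
  have hy_half : w / 2 ≤ y := by nlinarith
  calc |w * x - y| ≤ w * ε := by
        rw [abs_le]
        constructor <;> nlinarith
    _ = 2 * ε * (w / 2) := by ring
    _ ≤ 2 * ε * |y| := by
        gcongr
        exact hy_half.trans (le_abs_self y)

-- The weights `1 / ((j + 1) (j + 2))` with `j > n` add up to `1 / (n + 2)`, so the boundary term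
-- and the tail of the series are both `1 / (n + 2)` times an average of values `η(j)`, `j > n`,
-- which lie in `[1 - (1 / 2) ^ (n + 1), 1]`.
theorem abs_boundaryApprox_sub_le (n : ℕ) :
    |boundaryApprox n - aperyConstant| ≤ (1 / 2) ^ n * |plainApprox n - aperyConstant| := by
  have hplain : plainApprox n - aperyConstant =
      -(2 / 7 * Real.pi ^ 2 * ∑' j : ℕ, etaTerm (j + n + 1)) := by
    rw [← neg_sub, aperyConstant_sub_plainApprox_eq]
  have hboundary : boundaryApprox n - aperyConstant = 2 / 7 * Real.pi ^ 2 *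
      (1 / ((n : ℝ) + 2) * dirichletEta (n + 1 : ℕ) - ∑' j : ℕ, etaTerm (j + n + 1)) := by
    rw [boundaryApprox_eq, add_sub_right_comm, hplain]
    push_cast
    ring
  have hpow : ((1 : ℝ) / 2) ^ (n + 1) ≤ 1 / 2 :=
    pow_le_of_le_one (by norm_num) (by norm_num) n.succ_ne_zero
  have hcompare := abs_mul_sub_le_of_mem_Icc (by positivity) hpow
    (dirichletEta_mem_Icc_one_sub n.succ_ne_zero le_rfl) (tsum_etaTerm_mem_Icc n)
  rw [hplain, hboundary, abs_neg, abs_mul, abs_mul (2 / 7 * Real.pi ^ 2), mul_left_comm]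
  gcongr
  refine hcompare.trans_eq ?_
  rw [pow_succ]
  ring

theorem boundaryApprox_sub_isLittleO :
    (fun n => boundaryApprox n - aperyConstant) =o[atTop]
      fun n => plainApprox n - aperyConstant := by
  have hpow : (fun n : ℕ => ((1 : ℝ) / 2) ^ n) =o[atTop] fun _ => (1 : ℝ) :=
    (isLittleO_one_iff ℝ).2 (tendsto_pow_atTop_nhds_zero_of_lt_one (by norm_num) (by norm_num))
  have hbound : (fun n => boundaryApprox n - aperyConstant) =O[atTop]
      fun n => ((1 : ℝ) / 2) ^ n * (plainApprox n - aperyConstant) := by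
    refine IsBigO.of_bound' (.of_forall fun n => ?_)
    rw [norm_mul, norm_pow, Real.norm_of_nonneg one_half_pos.le]
    exact abs_boundaryApprox_sub_le n
  simpa using hbound.trans_isLittleO (hpow.mul_isBigO (isBigO_refl _ _))

theorem tendsto_plainApprox : Tendsto plainApprox atTop (𝓝 aperyConstant) := by
  rw [aperyConstant_eq_mul_tsum_etaTerm, funext plainApprox_eq]
  exact hasSum_etaTerm_succ.summable.hasSum.tendsto_sum_nat.const_mul _

theorem tendsto_boundaryApprox : Tendsto boundaryApprox atTop (𝓝 aperyConstant) :=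
  tendsto_sub_nhds_zero_iff.1 (boundaryApprox_sub_isLittleO.isBigO.trans_tendsto
    (tendsto_sub_nhds_zero_iff.2 tendsto_plainApprox))

end Convergence

theorem mainTheorem5 :
    dirichletEta 1 = Real.log 2 ∧
    Tendsto (fun n : ℕ => (boundaryApprox n : ℂ)) atTop (𝓝 (riemannZeta 3)) ∧
    Summable (fun j : ℕ+ => 1 / (((j : ℝ) + 1) * ((j : ℝ) + 2)) * dirichletEta j) ∧
    riemannZeta 3 =
      ((2 / 7 * Real.pi ^ 2 *
        ∑' j : ℕ+, 1 / (((j : ℝ) + 1) * ((j : ℝ) + 2)) * dirichletEta j : ℝ) : ℂ) ∧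
    (∀ n : ℕ, (plainApprox n : ℂ) ≠ riemannZeta 3) ∧
    (fun n : ℕ => (boundaryApprox n : ℂ) - riemannZeta 3) =o[atTop]
      (fun n : ℕ => (plainApprox n : ℂ) - riemannZeta 3) := by
  rw [riemannZeta_three]
  refine ⟨dirichletEta_one, (Complex.continuous_ofReal.tendsto _).comp tendsto_boundaryApprox,
    summable_pnat_iff_summable_succ (f := etaTerm) |>.2 hasSum_etaTerm_succ.summable, ?_,
    fun n => Complex.ofReal_injective.ne (plainApprox_lt_aperyConstant n).ne, ?_⟩
  · rw [aperyConstant_eq_mul_tsum_etaTerm, ← tsum_pnat_eq_tsum_succ (f := etaTerm)]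
    rfl
  · simp only [← Complex.ofReal_sub]
    exact IsLittleO.of_norm_norm <| by
      simpa only [Complex.norm_real] using boundaryApprox_sub_isLittleO.norm_norm
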